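/- Let $\mathbb T^3=(\mathbb R/2\pi\mathbb Z)^3$, let $\|\cdot\|$ and $\langle\cdot,\cdot\rangle$ be the norm and inner product of $L^2(\mathbb T^3)$ (for vector fields and for their gradients), and let $\mathcal H$ and $\mathcal V$ be the completions of the smooth divergence-free vector fields on $\mathbb T^3$ in $[L^2(\mathbb T^3)]^3$ and $[H^1(\mathbb T^3)]^3$ respectively; $\mathcal V'$ is the dual of $\mathcal V$, and $\mathcal V\subset\mathcal H\subset\mathcal V'$ via the $L^2$ inner product. A weak solution of the Navier–Stokes equations $\partial_t u+(u\cdot\nabla)u-\Delta u=-\nabla p$, $\nabla\cdot u=0$ on $\mathbb T^3\times(0,\infty)$ with initial data $u_0\in\mathcal H$ is a function $u$ (determined up to null sets of times) with $u\in L^\infty(0,T;\mathcal H)\cap L^2(0,T;\mathcal V)$ for all $T>0$ such that, for every compactly supported smooth vector field $\varphi$ on $[0,\infty)\times\mathbb T^3$ with $\nabla\cdot\varphi(t)=0$ for all $t\ge 0$, and for almost every $s>0$, $$-\int_0^s\langle u,\partial_t\varphi\rangle\,dt+\int_0^s\langle\nabla u,\nabla\varphi\rangle\,dt+\int_0^s\langle(u\cdot\nabla)u,\varphi\rangle\,dt=\langle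 u_0,\varphi(0)\rangle-\langle u(s),\varphi(s)\rangle .$$ A version of $u$ is a function $[0,\infty)\to\mathcal H$ that equals $u$ at almost every time. A weak solution $u$ is a Leray–Hopf weak solution if it has a (necessarily unique) version $\tilde u\in C([0,\infty),\mathcal V')$ with values in $\mathcal H$, and this version satisfies the strong energy inequality: for $s=0$ and for almost every $s\in(0,\infty)$, $$\tfrac12\|\tilde u(t)\|^2+\int_s^t\|\nabla u(r)\|^2\,dr\le\tfrac12\|\tilde u(s)\|^2\qquad\text{for all } t>s .$$ **Theorem.** Let $u$ be a weak solution with initial data $u_0\in\mathcal H$. Then the following are equivalent: 1. there exists a version $\bar u$ of $u$ such that $t\mapsto\|\bar u(t)\|^2$ is monotone non-increasing on $[0,\infty)$ and $\|\bar u(0)\|=\|u_0\|$; 2. $u$ is a Leray–Hopf weak solution. -/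

import Mathlib

open MeasureTheory Set Filter
open scoped ENNReal ContDiff Topology

noncomputable section

namespace NSTorus

instance factTwoPiPos : Fact (0 < 2 * Real.pi) := ⟨Real.two_pi_pos⟩

/-- The torus `𝕋³ = (ℝ / 2πℤ)³`, with its Lebesgue measure `volume` of total mass `(2π)³`. -/
abbrev Torus : Type := Fin 3 → AddCircle (2 * Real.pi)

/-- Euclidean three-space, where velocities take their values. -/
abbrev E3 : Type := EuclideanSpace ℝ (Fin 3)

/-- The quotient map `ℝ³ → 𝕋³`. -/
def proj (y : Fin 3 → ℝ) : Torus := fun i => (y i : AddCircle (2 * Real.pi))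

/-- The `i`-th partial derivative of a vector field on the torus. -/
def partialDeriv (i : Fin 3) (f : Torus → E3) (x : Torus) : E3 :=
  deriv (fun s : ℝ => f (x + Pi.single i (s : AddCircle (2 * Real.pi)))) 0

/-- A vector field on the torus is smooth if its periodic lift to `ℝ³` is `C^∞`. -/
def IsSmooth (f : Torus → E3) : Prop :=
  ContDiff ℝ ∞ (fun y : Fin 3 → ℝ => f (proj y))

/-- The divergence `∑ᵢ ∂ᵢ fᵢ`. -/
def divergence (f : Torus → E3) (x : Torus) : ℝ :=
  ∑ i, partialDeriv i f x i

/-- Smooth divergence-free vector fields on the torus. -/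
def IsSmoothDivFree (f : Torus → E3) : Prop :=
  IsSmooth f ∧ ∀ x, divergence f x = 0

theorem IsSmooth.hasDerivAt {f : Torus → E3} (hf : IsSmooth f) (i : Fin 3) (x : Torus) :
    HasDerivAt (fun s : ℝ => f (x + Pi.single i (s : AddCircle (2 * Real.pi))))
      (partialDeriv i f x) 0 := by
  have hx : ∃ y : Fin 3 → ℝ, proj y = x := by
    choose y hy using fun j => QuotientAddGroup.mk_surjective (x j)
    exact ⟨y, funext hy⟩
  obtain ⟨y, rfl⟩ := hx
  have key : (fun s : ℝ => f (proj y + Pi.single i (s : AddCircle (2 * Real.pi))))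
      = (fun z : Fin 3 → ℝ => f (proj z)) ∘ (fun s : ℝ => y + Pi.single i s) := by
    funext s
    simp only [Function.comp]
    congr 1
    funext j
    by_cases h : j = i
    · subst h; simp [proj]
    · simp [proj, h]
  have hd : DifferentiableAt ℝ
      (fun s : ℝ => f (proj y + Pi.single i (s : AddCircle (2 * Real.pi)))) 0 := by
    rw [key]
    refine DifferentiableAt.comp _ ((hf.differentiable (by simp)) _) ?_
    refine (differentiableAt_const _).add ?_
    exact (ContinuousLinearMap.single ℝ (fun _ : Fin 3 => ℝ) i).differentiableAt
  exact hd.hasDerivAt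

theorem IsSmooth.partialDeriv_add {f g : Torus → E3} (hf : IsSmooth f) (hg : IsSmooth g)
    (i : Fin 3) (x : Torus) :
    partialDeriv i (f + g) x = partialDeriv i f x + partialDeriv i g x :=
  ((hf.hasDerivAt i x).add (hg.hasDerivAt i x)).deriv

theorem IsSmooth.partialDeriv_smul {f : Torus → E3} (hf : IsSmooth f) (c : ℝ)
    (i : Fin 3) (x : Torus) :
    partialDeriv i (c • f) x = c • partialDeriv i f x :=
  ((hf.hasDerivAt i x).const_smul c).deriv

theorem partialDeriv_zero (i : Fin 3) (x : Torus) : partialDeriv i 0 x = 0 := by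
  simp [partialDeriv]

theorem isSmoothDivFree_zero : IsSmoothDivFree 0 :=
  ⟨contDiff_const, fun x => by simp [divergence, partialDeriv_zero]⟩

theorem IsSmoothDivFree.add {f g : Torus → E3} (hf : IsSmoothDivFree f)
    (hg : IsSmoothDivFree g) : IsSmoothDivFree (f + g) := by
  refine ⟨ContDiff.add hf.1 hg.1, fun x => ?_⟩
  have h1 := hf.2 x
  have h2 := hg.2 x
  simp only [divergence] at h1 h2 ⊢
  simp [hf.1.partialDeriv_add hg.1, Finset.sum_add_distrib, h1, h2]

theorem IsSmoothDivFree.smul {f : Torus → E3} (c : ℝ) (hf : IsSmoothDivFree f) :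
    IsSmoothDivFree (c • f) := by
  refine ⟨ContDiff.const_smul c hf.1, fun x => ?_⟩
  have h1 := hf.2 x
  simp only [divergence] at h1 ⊢
  simp [hf.1.partialDeriv_smul, ← Finset.mul_sum, h1]

/-- The space `[L²(𝕋³)]³`. -/
abbrev L2 : Type := Lp E3 2 (volume : Measure Torus)

/-- The Hilbert space in which `[H¹(𝕋³)]³` is embedded by `v ↦ (v, (∂₁v, ∂₂v, ∂₃v))`; its norm is
`‖(v, g)‖² = ‖v‖² + ∑ᵢ ‖gᵢ‖²`, the `H¹` norm when `gᵢ = ∂ᵢ v`. -/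
abbrev H1Ambient : Type := WithLp 2 (L2 × PiLp 2 (fun _ : Fin 3 => L2))

/-- The smooth divergence-free vector fields, as elements of `[L²(𝕋³)]³`. -/
def smoothDivFreeL2 : Submodule ℝ L2 where
  carrier := {v | ∃ f : Torus → E3, IsSmoothDivFree f ∧ v =ᵐ[volume] f}
  zero_mem' := ⟨0, isSmoothDivFree_zero, Lp.coeFn_zero _ _ _⟩
  add_mem' := by
    rintro v w ⟨f, hf, hvf⟩ ⟨g, hg, hwg⟩
    exact ⟨f + g, hf.add hg, (Lp.coeFn_add v w).trans (hvf.add hwg)⟩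
  smul_mem' := by
    rintro c v ⟨f, hf, hvf⟩
    exact ⟨c • f, hf.smul c, (Lp.coeFn_smul c v).trans (hvf.const_smul c)⟩

/-- The smooth divergence-free vector fields together with their first derivatives, as elements of
`[H¹(𝕋³)]³`. -/
def smoothDivFreeH1 : Submodule ℝ H1Ambient where
  carrier := {w | ∃ f : Torus → E3, IsSmoothDivFree f ∧ w.fst =ᵐ[volume] f ∧
    ∀ i, w.snd i =ᵐ[volume] partialDeriv i f}
  zero_mem' := by
    refine ⟨0, isSmoothDivFree_zero, Lp.coeFn_zero _ _ _, fun i => ?_⟩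
    have : partialDeriv i 0 = 0 := funext (partialDeriv_zero i)
    rw [this]
    exact Lp.coeFn_zero _ _ _
  add_mem' := by
    rintro v w ⟨f, hf, hvf, hvf'⟩ ⟨g, hg, hwg, hwg'⟩
    refine ⟨f + g, hf.add hg, (Lp.coeFn_add v.fst w.fst).trans (hvf.add hwg), fun i => ?_⟩
    have : partialDeriv i (f + g) = partialDeriv i f + partialDeriv i g :=
      funext (hf.1.partialDeriv_add hg.1 i)
    rw [this]
    exact (Lp.coeFn_add (v.snd i) (w.snd i)).trans ((hvf' i).add (hwg' i))
  smul_mem' := by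
    rintro c v ⟨f, hf, hvf, hvf'⟩
    refine ⟨c • f, hf.smul c, (Lp.coeFn_smul c v.fst).trans (hvf.const_smul c), fun i => ?_⟩
    have : partialDeriv i (c • f) = c • partialDeriv i f :=
      funext (hf.1.partialDeriv_smul c i)
    rw [this]
    exact (Lp.coeFn_smul c (v.snd i)).trans ((hvf' i).const_smul c)

/-- `𝓗`: the completion of the smooth divergence-free vector fields in `[L²(𝕋³)]³`. -/
def spaceH : Submodule ℝ L2 := smoothDivFreeL2.topologicalClosure

/-- `𝓥`: the completion of the smooth divergence-free vector fields in `[H¹(𝕋³)]³`. -/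
def spaceV : Submodule ℝ H1Ambient := smoothDivFreeH1.topologicalClosure

/-- The continuous linear map `(v, ∇v) ↦ v` on the ambient space. -/
def fstL : H1Ambient →L[ℝ] L2 := WithLp.fstL 2 ℝ L2 (PiLp 2 (fun _ : Fin 3 => L2))

theorem fstL_mem_spaceH (v : spaceV) : fstL (v : H1Ambient) ∈ spaceH := by
  have h : MapsTo fstL (smoothDivFreeH1 : Set H1Ambient) (smoothDivFreeL2 : Set L2) := by
    rintro w ⟨f, hf, hwf, -⟩
    exact ⟨f, hf, hwf⟩
  exact h.closure fstL.continuous v.2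

/-- The inclusion `𝓥 ⊂ 𝓗`. -/
def incl : spaceV →L[ℝ] spaceH :=
  (fstL.comp spaceV.subtypeL).codRestrict spaceH fstL_mem_spaceH

/-- The derivative `∂ᵢ v ∈ [L²(𝕋³)]³` of `v ∈ 𝓥`. -/
def dV (v : spaceV) (i : Fin 3) : L2 := (v : H1Ambient).snd i

/-- `‖∇v‖² = ∑ᵢ ‖∂ᵢ v‖²`, with `L²` norms, for `v ∈ 𝓥`. -/
def gradNormSq (v : spaceV) : ℝ := ∑ i, ‖dV v i‖ ^ 2

/-- The inclusion `𝓗 ⊂ 𝓥'`: `h` acts on `𝓥` by `v ↦ ⟨h, v⟩`, the `L²` inner product. -/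
def toVDual (h : spaceH) : StrongDual ℝ spaceV := (innerSL ℝ h).comp incl

/-- Divergence-free test functions: the restrictions to `t ≥ 0` are the smooth vector fields on
`[0, ∞) × 𝕋³` that have compact support and are divergence-free at every time `t ≥ 0`. -/
structure IsTestFunction (φ : ℝ → Torus → E3) : Prop where
  smooth : ContDiff ℝ ∞ (fun p : ℝ × (Fin 3 → ℝ) => φ p.1 (proj p.2))
  compactSupport : ∃ T : ℝ, ∀ t, T ≤ t → φ t = 0
  divFree : ∀ t, 0 ≤ t → ∀ x, divergence (φ t) x = 0

/-- The time derivative `∂ₜ φ`. -/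
def timeDeriv (φ : ℝ → Torus → E3) (t : ℝ) (x : Torus) : E3 := deriv (fun r => φ r x) t

/-- The pairing `⟨f, g⟩ = ∫ f · g dx` over the torus. -/
def pairing (f g : Torus → E3) : ℝ := ∫ x, inner ℝ (f x) (g x)

/-- `⟨∇v, ∇ψ⟩ = ∑ᵢ ⟨∂ᵢ v, ∂ᵢ ψ⟩`. -/
def gradPairing (v : spaceV) (ψ : Torus → E3) : ℝ :=
  ∑ i, pairing (dV v i) (partialDeriv i ψ)

/-- The field `(v · ∇)v = ∑ᵢ vᵢ ∂ᵢ v`. -/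
def convection (v : spaceV) (x : Torus) : E3 :=
  ∑ i, (incl v : L2) x i • dV v i x

/-- `u` is a weak solution of the Navier–Stokes equations (viscosity one, no force) with initial
data `u₀ ∈ 𝓗`. A weak solution lies in `𝓥` for almost every time and is determined up to null sets
of times, so it is represented by a function with values in `𝓥`, whose values at `t ≤ 0` and on any
null set of times play no role:
`u ∈ L^∞(0,T;𝓗) ∩ L²(0,T;𝓥)` for all `T > 0`, and for all test functions `φ` and almost every
`s > 0`,
`-∫₀ˢ ⟨u, ∂ₜφ⟩ + ∫₀ˢ ⟨∇u, ∇φ⟩ + ∫₀ˢ ⟨(u·∇)u, φ⟩ = ⟨u₀, φ(0)⟩ - ⟨u(s), φ(s)⟩`. -/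
structure IsWeakSolution (u₀ : spaceH) (u : ℝ → spaceV) : Prop where
  memLinftyH : ∀ T : ℝ, 0 < T →
    MemLp (fun t => incl (u t)) ∞ (volume.restrict (Ioo 0 T))
  memL2V : ∀ T : ℝ, 0 < T → MemLp u 2 (volume.restrict (Ioo 0 T))
  weakForm : ∀ φ : ℝ → Torus → E3, IsTestFunction φ →
    ∀ᵐ s ∂(volume.restrict (Ioi (0 : ℝ))),
      -(∫ t in (0 : ℝ)..s, pairing (incl (u t) : L2) (timeDeriv φ t))
        + (∫ t in (0 : ℝ)..s, gradPairing (u t) (φ t))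
        + (∫ t in (0 : ℝ)..s, pairing (convection (u t)) (φ t))
      = pairing (u₀ : L2) (φ 0) - pairing (incl (u s) : L2) (φ s)

/-- `w : [0, ∞) → 𝓗` is a version of `u`: the two agree at almost every time. -/
def IsVersion (w : ℝ → spaceH) (u : ℝ → spaceV) : Prop :=
  ∀ᵐ t ∂(volume.restrict (Ioi (0 : ℝ))), w t = incl (u t)

/-- The energy inequality of `w` (a version of `u`) from time `s` on:
`½‖w(t)‖² + ∫ₛᵗ ‖∇u‖² ≤ ½‖w(s)‖²` for all `t > s`. -/
def EnergyInequalityFrom (u : ℝ → spaceV) (w : ℝ → spaceH) (s : ℝ) : Prop :=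
  ∀ t, s < t →
    1 / 2 * ‖w t‖ ^ 2 + ∫ r in s..t, gradNormSq (u r) ≤ 1 / 2 * ‖w s‖ ^ 2

/-- `u` is a Leray–Hopf weak solution with initial data `u₀`: a weak solution whose version in
`C([0, ∞), 𝓥')` (unique, as two such versions agree almost everywhere) satisfies the strong energy
inequality, that is, the energy inequality from `s = 0` and from almost every `s ∈ (0, ∞)`. -/
def IsLerayHopf (u₀ : spaceH) (u : ℝ → spaceV) : Prop :=
  IsWeakSolution u₀ u ∧
    ∃ w : ℝ → spaceH, IsVersion w u ∧
      ContinuousOn (fun t => toVDual (w t)) (Ici 0) ∧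
      EnergyInequalityFrom u w 0 ∧
      ∀ᵐ s ∂(volume.restrict (Ioi (0 : ℝ))), EnergyInequalityFrom u w s

end NSTorus

end

noncomputable section

namespace NSTorus

open scoped NNReal

/-! Everything rests on reading the equation in 𝓥'. The Sobolev embedding 𝓥 ⊂ L⁴ bounds `w ↦
⟨(v·∇)v, w⟩` by C‖v‖² in 𝓥', so for u ∈ L²(0,T;𝓥) the right-hand side Δu − (u·∇)u is integrable in
time with values in 𝓥'. Its primitive `evolution` is continuous into 𝓥', differentiable at almost
every time, and equal to u at almost every time. The convective form vanishes on the diagonal, so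
the right-hand side tested with u itself gives −‖∇u‖².

Monotone norm implies Leray–Hopf. For almost all q < r, ½‖ū(q)‖² − ½‖ū(r)‖² ≥ ⟨ū(q) − ū(r), u(r)⟩,
and the right side is an increment of `evolution` tested with the fixed field u(r) ∈ 𝓥. Dividing by
r − q and letting q ↑ r gives −(½‖ū‖²)' ≥ ‖∇u‖² at almost every r. A monotone function dominates the
integral of its derivative, so ū satisfies the energy inequality from every s
(`IsWeakSolution.energyInequalityFrom`). Weak lower semicontinuity carries it to the 𝓥'-continuous
version w, from each s with ‖w(s)‖ = ‖ū(s)‖: from 0 and from almost every s.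

Leray–Hopf implies monotone norm. The norm of w is already non-increasing on the set of times from
which the energy inequality holds. On the remaining null set, w is replaced by vectors whose norm
fills in a monotone function (`exists_antitoneOn_of_energyInequality`). -/

/-! ### Calculus on the torus through periodic lifts -/

theorem isOpenQuotientMap_proj : IsOpenQuotientMap proj :=
  IsOpenQuotientMap.piMap (fun _ : Fin 3 => QuotientAddGroup.isOpenQuotientMap_mk)

theorem continuous_proj : Continuous proj := isOpenQuotientMap_proj.continuous

theorem proj_add_single (y : Fin 3 → ℝ) (i : Fin 3) (s : ℝ) :
    proj (y + Pi.single i s) = proj y + Pi.single i (s : AddCircle (2 * Real.pi)) := by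
  funext j
  by_cases h : j = i
  · subst h; simp [proj]
  · simp [proj, h]

theorem continuous_of_continuous_comp_proj {X : Type*} [TopologicalSpace X] {f : Torus → X}
    (hf : Continuous fun y => f (proj y)) : Continuous f :=
  isOpenQuotientMap_proj.isQuotientMap.continuous_iff.2 hf

theorem IsSmooth.continuous {f : Torus → E3} (hf : IsSmooth f) : Continuous f :=
  continuous_of_continuous_comp_proj (ContDiff.continuous hf)

theorem IsSmooth.partialDeriv_proj {f : Torus → E3} (hf : IsSmooth f) (i : Fin 3)
    (y : Fin 3 → ℝ) :
    partialDeriv i f (proj y) = fderiv ℝ (fun z => f (proj z)) y (Pi.single i 1) := by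
  refine (hf.hasDerivAt i (proj y)).unique ?_
  simp_rw [← proj_add_single]
  have h1 : HasFDerivAt (fun z => f (proj z)) (fderiv ℝ (fun z => f (proj z)) y)
      (y + Pi.single i (0 : ℝ)) := by
    simpa using (hf.differentiable (by simp) y).hasFDerivAt
  have h2 : HasDerivAt (fun s : ℝ => y + Pi.single i s) (Pi.single i (1 : ℝ)) 0 :=
    (hasDerivAt_single i (0 : ℝ)).const_add y
  exact h1.comp_hasDerivAt (0 : ℝ) h2

theorem IsSmooth.continuous_partialDeriv {f : Torus → E3} (hf : IsSmooth f) (i : Fin 3) :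
    Continuous (partialDeriv i f) := by
  refine continuous_of_continuous_comp_proj ?_
  simp_rw [hf.partialDeriv_proj]
  exact (ContDiff.continuous_fderiv hf (by simp)).clm_apply continuous_const

theorem measurePreserving_proj (a : Fin 3 → ℝ) :
    MeasurePreserving proj
      (volume.restrict (univ.pi fun i => Ioc (a i) (a i + 2 * Real.pi))) volume := by
  have h := measurePreserving_pi (fun i : Fin 3 => volume.restrict (Ioc (a i) (a i + 2 * Real.pi)))
    (fun _ : Fin 3 => (volume : Measure (AddCircle (2 * Real.pi))))
    (fun i => AddCircle.measurePreserving_mk (2 * Real.pi) (a i))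
  rw [← Measure.restrict_pi_pi] at h
  exact h

/-- The integral over the torus of a partial derivative vanishes. -/
theorem integral_eq_zero_of_hasDerivAt {i : Fin 3} {f f' : Torus → ℝ} (hf : Continuous f)
    (hf' : Continuous f')
    (h : ∀ x, HasDerivAt (fun s : ℝ => f (x + Pi.single i (s : AddCircle (2 * Real.pi))))
      (f' x) 0) :
    ∫ x, f' x = 0 := by
  obtain ⟨C, hC⟩ := isCompact_univ.exists_bound_of_continuousOn hf'.continuousOn
  let e : ℝ → Torus := fun s => Pi.single i (s : AddCircle (2 * Real.pi))
  have he : ∀ r s, e (r + s) = e r + e s := fun r s => by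
    simp only [e, AddCircle.coe_add, Pi.single_add]
  have hint : ∀ g : Torus → ℝ, Continuous g → Integrable g := fun g hg =>
    hg.integrable_of_hasCompactSupport (HasCompactSupport.of_compactSpace g)
  -- Differentiate `s ↦ ∫ f (x + e s)` under the integral sign; by translation invariance this
  -- function is constant, so its derivative at 0, which is `∫ f'`, vanishes.
  have key := (hasDerivAt_integral_of_dominated_loc_of_deriv_le (μ := (volume : Measure Torus))
    (F := fun s x => f (x + e s)) (F' := fun s x => f' (x + e s)) (x₀ := (0 : ℝ)) (s := univ)
    (bound := fun _ => C) Filter.univ_mem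
    (Eventually.of_forall fun s =>
      (hf.comp (continuous_add_const (e s))).aestronglyMeasurable)
    (hint _ (hf.comp (continuous_add_const (e 0))))
    (hf'.comp (continuous_add_const (e 0))).aestronglyMeasurable
    (Eventually.of_forall fun x s _ => hC _ (mem_univ _))
    (integrable_const C)
    (Eventually.of_forall fun x s _ => by
      have h1 := h (x + e s)
      have h2 : HasDerivAt (fun r : ℝ => r - s) 1 s := (hasDerivAt_id s).sub_const s
      have h3 := HasDerivAt.scomp_of_eq s h1 h2 (by simp)
      simp only [one_smul] at h3
      refine h3.congr_of_eventuallyEq (Eventually.of_forall fun r => ?_)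
      change f (x + e r) = f (x + e s + e (r - s))
      rw [add_assoc, ← he, add_sub_cancel])).2
  have hconst : (fun s : ℝ => ∫ x, f (x + e s)) = fun _ => ∫ x, f x :=
    funext fun s => integral_add_right_eq_self f (e s)
  rw [hconst] at key
  have h0 := key.unique (hasDerivAt_const _ _)
  simpa [e] using h0

/-! ### Sobolev inequality on the torus by cutting off the periodic lift -/

/-- The box is covered by 27 = 3³ translates of a period cube, each of which projects onto the torus
preserving measure. This brings L² norms of the cut-off lift back to the torus. -/
theorem map_proj_restrict_le :
    (volume.restrict (univ.pi fun _ : Fin 3 => Ioc (-(2 * Real.pi)) (4 * Real.pi))).map proj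
      ≤ (27 : ℝ≥0∞) • (volume : Measure Torus) := by
  let a : (Fin 3 → Fin 3) → Fin 3 → ℝ := fun k i => 2 * Real.pi * (((k i : ℕ) : ℝ) - 1)
  let D : (Fin 3 → Fin 3) → Set (Fin 3 → ℝ) :=
    fun k => univ.pi fun i => Ioc (a k i) (a k i + 2 * Real.pi)
  have hpi := Real.pi_pos
  have hD : (univ.pi fun _ : Fin 3 => Ioc (-(2 * Real.pi)) (4 * Real.pi)) ⊆ ⋃ k, D k := by
    intro y hy
    have : ∀ i, ∃ k : Fin 3, y i ∈ Ioc (2 * Real.pi * (((k : ℕ) : ℝ) - 1))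
        (2 * Real.pi * (((k : ℕ) : ℝ) - 1) + 2 * Real.pi) := by
      intro i
      have hi := hy i (mem_univ i)
      simp only [mem_Ioc] at hi
      rcases le_or_gt (y i) 0 with h0 | h0
      · exact ⟨0, by constructor <;> norm_num <;> linarith⟩
      rcases le_or_gt (y i) (2 * Real.pi) with h1 | h1
      · exact ⟨1, by constructor <;> norm_num <;> linarith⟩
      · exact ⟨2, by constructor <;> norm_num <;> linarith⟩
    choose k hk using this
    exact mem_iUnion.2 ⟨k, fun i _ => hk i⟩
  calc (volume.restrict (univ.pi fun _ : Fin 3 => Ioc (-(2 * Real.pi)) (4 * Real.pi))).map proj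
      ≤ (Measure.sum fun k => volume.restrict (D k)).map proj :=
        Measure.map_mono ((Measure.restrict_mono hD le_rfl).trans Measure.restrict_iUnion_le)
          continuous_proj.measurable
    _ = Measure.sum fun k => (volume.restrict (D k)).map proj :=
        Measure.map_sum continuous_proj.aemeasurable
    _ = Measure.sum fun _ : Fin 3 → Fin 3 => (volume : Measure Torus) := by
        congr 1; funext k; exact (measurePreserving_proj (a k)).map_eq
    _ ≤ (27 : ℝ≥0∞) • (volume : Measure Torus) := by
        refine Measure.le_iff.2 fun s hs => ?_
        rw [Measure.sum_apply _ hs]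
        simp

theorem norm_le_sum_norm_apply_single {F : Type*} [NormedAddCommGroup F] [NormedSpace ℝ F]
    (A : (Fin 3 → ℝ) →L[ℝ] F) : ‖A‖ ≤ ∑ i, ‖A (Pi.single i 1)‖ := by
  refine A.opNorm_le_bound (Finset.sum_nonneg fun i _ => norm_nonneg _) fun y => ?_
  have hy : y = ∑ i, y i • (Pi.single i 1 : Fin 3 → ℝ) := by
    funext j; simp [Finset.sum_apply, Pi.single_apply]
  conv_lhs => rw [hy]
  rw [map_sum, Finset.sum_mul]
  refine (norm_sum_le _ _).trans (Finset.sum_le_sum fun i _ => ?_)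
  rw [map_smul, norm_smul, mul_comm]
  exact mul_le_mul_of_nonneg_left (norm_le_pi_norm y i) (norm_nonneg _)

/-- The Sobolev embedding `H¹(𝕋³) ⊂ L⁴(𝕋³)`, for smooth fields. -/
theorem exists_eLpNorm_four_le : ∃ C : ℝ≥0, ∀ f : Torus → E3, IsSmooth f →
    eLpNorm f 4 volume
      ≤ C * (eLpNorm f 2 volume + ∑ i, eLpNorm (partialDeriv i f) 2 volume) := by
  have hpi := Real.pi_gt_three
  have hpi4 := Real.pi_lt_four
  let c : Fin 3 → ℝ := fun _ => Real.pi
  -- Balls are cubes in the sup norm. Since π < 4, the cutoff is 1 on the period cube (0, 2π]³;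
  -- since 5 < 3π, its support stays inside the box `D`.
  let χ : ContDiffBump c := ⟨4, 5, by norm_num, by norm_num⟩
  have hχ : ContDiff ℝ ∞ (χ : (Fin 3 → ℝ) → ℝ) := χ.contDiff
  obtain ⟨M, hM⟩ := (hχ.continuous_fderiv (by simp)).bounded_above_of_compact_support
    (χ.hasCompactSupport.fderiv ℝ)
  have hM0 : 0 ≤ M := (norm_nonneg _).trans (hM 0)
  set K : ℝ≥0 := eLpNormLESNormFDerivOfLeConst E3 (volume : Measure (Fin 3 → ℝ))
    (Metric.ball c 5) 2 4 with hK
  obtain ⟨N, hN1, hNM⟩ : ∃ N : ℝ≥0, (1 : ℝ) ≤ N ∧ M ≤ N :=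
    ⟨max 1 M.toNNReal, by exact_mod_cast le_max_left _ _,
      (Real.le_coe_toNNReal M).trans (by exact_mod_cast le_max_right _ _)⟩
  let D : Set (Fin 3 → ℝ) := univ.pi fun _ : Fin 3 => Ioc (-(2 * Real.pi)) (4 * Real.pi)
  obtain ⟨c27, hc27⟩ : ∃ r : ℝ≥0, (27 : ℝ≥0∞) ^ (1 / (2 : ℝ≥0∞)).toReal = r :=
    ⟨((27 : ℝ≥0∞) ^ (1 / (2 : ℝ≥0∞)).toReal).toNNReal, (ENNReal.coe_toNNReal
      (ENNReal.rpow_ne_top_of_nonneg ENNReal.toReal_nonneg (by norm_num))).symm⟩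
  refine ⟨K * (c27 * N), fun f hf => ?_⟩
  let g : (Fin 3 → ℝ) → E3 := fun y => χ y • f (proj y)
  have hg : ContDiff ℝ ∞ g := hχ.smul hf
  have hgsupp : g.support ⊆ Metric.ball c 5 := by
    intro y hy
    have : χ y ≠ 0 := fun h => hy (by simp [g, h])
    have h2 : y ∈ Function.support χ := this
    rwa [χ.support_eq] at h2
  let h : Torus → ℝ := fun x => ‖f x‖ + ∑ i, ‖partialDeriv i f x‖
  have hhc : Continuous h := hf.continuous.norm.add
    (continuous_finsetSum _ fun i _ => (hf.continuous_partialDeriv i).norm)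
  have h1 : eLpNorm f 4 volume ≤ eLpNorm g 4 volume := by
    rw [← (measurePreserving_proj 0).map_eq, eLpNorm_map_measure
      hf.continuous.aestronglyMeasurable continuous_proj.aemeasurable]
    refine le_trans (le_of_eq (eLpNorm_congr_ae ?_))
      (eLpNorm_mono_measure g Measure.restrict_le_self)
    refine (ae_restrict_iff' (MeasurableSet.univ_pi fun i => measurableSet_Ioc)).2
      (Eventually.of_forall fun y hy => ?_)
    have : χ y = 1 := by
      refine χ.one_of_mem_closedBall ?_
      rw [Metric.mem_closedBall, dist_pi_le_iff (by positivity)]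
      intro i
      have hi := hy i (mem_univ i)
      simp only [mem_Ioc, Pi.zero_apply] at hi
      rw [Real.dist_eq, abs_le]
      change -4 ≤ y i - Real.pi ∧ y i - Real.pi ≤ 4
      constructor <;> linarith
    simp [g, this]
  -- Gagliardo–Nirenberg–Sobolev in dimension 3 with p = 2: the exponent 4 is below the critical 6,
  -- which is allowed because the support is bounded.
  have h2 : eLpNorm g 4 volume ≤ K * eLpNorm (fderiv ℝ g) 2 volume := by
    have := eLpNorm_le_eLpNorm_fderiv_of_le (volume : Measure (Fin 3 → ℝ))
      (hg.of_le (by simp)) hgsupp (p := 2) (q := 4) (by norm_num)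
      (by simp; norm_num) (by simp; norm_num)
      Metric.isBounded_ball
    simpa [hK] using this
  have hsupp : Function.support (fderiv ℝ g) ⊆ D := by
    intro y hy
    have hy' : y ∈ tsupport g := support_fderiv_subset ℝ hy
    have hy2 : y ∈ Metric.closedBall c 5 :=
      closure_minimal (hgsupp.trans Metric.ball_subset_closedBall) Metric.isClosed_closedBall hy'
    rw [Metric.mem_closedBall, dist_pi_le_iff (by positivity)] at hy2
    intro i _
    have hi := hy2 i
    rw [Real.dist_eq, abs_le] at hi
    change -5 ≤ y i - Real.pi ∧ y i - Real.pi ≤ 5 at hi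
    constructor <;> linarith [hi.1, hi.2]
  have hbound : ∀ y, ‖fderiv ℝ g y‖ ≤ N * ‖h (proj y)‖ := by
    intro y
    have hd1 : DifferentiableAt ℝ χ y := hχ.differentiable (by simp) y
    have hd2 : DifferentiableAt ℝ (fun z => f (proj z)) y := hf.differentiable (by simp) y
    have e : fderiv ℝ g y = χ y • fderiv ℝ (fun z => f (proj z)) y +
        (fderiv ℝ χ y).smulRight (f (proj y)) := fderiv_fun_smul hd1 hd2
    have hh : 0 ≤ h (proj y) := by positivity
    have n1 : ‖χ y • fderiv ℝ (fun z => f (proj z)) y‖ ≤ ∑ i, ‖partialDeriv i f (proj y)‖ := by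
      rw [norm_smul, Real.norm_of_nonneg χ.nonneg]
      calc χ y * ‖fderiv ℝ (fun z => f (proj z)) y‖
          ≤ 1 * ‖fderiv ℝ (fun z => f (proj z)) y‖ :=
            mul_le_mul_of_nonneg_right χ.le_one (norm_nonneg _)
        _ ≤ _ := by
            rw [one_mul]
            refine (norm_le_sum_norm_apply_single _).trans (le_of_eq ?_)
            simp_rw [hf.partialDeriv_proj]
    have n2 : ‖(fderiv ℝ χ y).smulRight (f (proj y))‖ ≤ M * ‖f (proj y)‖ := by
      rw [ContinuousLinearMap.norm_smulRight_apply]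
      exact mul_le_mul_of_nonneg_right (hM y) (norm_nonneg _)
    rw [e, Real.norm_of_nonneg hh]
    refine (norm_add_le _ _).trans ((add_le_add n1 n2).trans ?_)
    have s0 : 0 ≤ ∑ i, ‖partialDeriv i f (proj y)‖ := by positivity
    have := mul_le_mul_of_nonneg_right hN1 s0
    have := mul_le_mul_of_nonneg_right hNM (norm_nonneg (f (proj y)))
    simp only [h]
    linarith
  have h3 : eLpNorm (fderiv ℝ g) 2 volume ≤ N * (c27 * eLpNorm h 2 volume) := by
    have h5 : eLpNorm (fderiv ℝ g) 2 (volume.restrict D)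
        ≤ ENNReal.ofReal N * eLpNorm (h ∘ proj) 2 (volume.restrict D) :=
      eLpNorm_le_mul_eLpNorm_of_ae_le_mul (ae_of_all _ hbound) 2
    have h6 : eLpNorm (fun y => ‖fderiv ℝ g y‖) 2 (volume.restrict D)
        = eLpNorm (fun y => ‖fderiv ℝ g y‖) 2 volume :=
      eLpNorm_restrict_eq_of_support_subset fun y hy => hsupp fun h0 => hy (by simp [h0])
    rw [eLpNorm_norm, eLpNorm_norm] at h6
    calc eLpNorm (fderiv ℝ g) 2 volume = eLpNorm (fderiv ℝ g) 2 (volume.restrict D) :=h6.symm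
      _ ≤ ENNReal.ofReal N * eLpNorm (h ∘ proj) 2 (volume.restrict D) := h5
      _ = N * eLpNorm h 2 ((volume.restrict D).map proj) := by
          rw [eLpNorm_map_measure hhc.aestronglyMeasurable continuous_proj.aemeasurable,
            ENNReal.ofReal_coe_nnreal]
      _ ≤ N * eLpNorm h 2 ((27 : ℝ≥0∞) • volume) := by
          gcongr
          exact map_proj_restrict_le
      _ = _ := by
          rw [eLpNorm_smul_measure_of_ne_top (by norm_num), smul_eq_mul, ← hc27]
  have h4 : eLpNorm h 2 volume
      ≤ eLpNorm f 2 volume + ∑ i, eLpNorm (partialDeriv i f) 2 volume := by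
    have hm : ∀ i, AEStronglyMeasurable (fun x => ‖partialDeriv i f x‖) volume := fun i =>
      (hf.continuous_partialDeriv i).norm.aestronglyMeasurable
    have e1 : h = (fun x => ‖f x‖) + ∑ i, fun x => ‖partialDeriv i f x‖ := by
      funext x; simp [h]
    rw [e1]
    refine (eLpNorm_add_le hf.continuous.norm.aestronglyMeasurable
      (Finset.aestronglyMeasurable_sum _ fun i _ => hm i) (by norm_num)).trans ?_
    gcongr
    · rw [eLpNorm_norm]
    · refine (eLpNorm_sum_le (fun i _ => hm i) (by norm_num)).trans (le_of_eq ?_)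
      simp_rw [eLpNorm_norm]
  calc eLpNorm f 4 volume ≤ K * (N * (c27 * eLpNorm h 2 volume)) :=
        h1.trans (h2.trans (by gcongr))
    _ ≤ K * (N * (c27 * (eLpNorm f 2 volume + ∑ i, eLpNorm (partialDeriv i f) 2 volume))) := by
        gcongr
    _ = _ := by push_cast; ring

/-! ### The spaces 𝓗 and 𝓥, and the embedding of 𝓥 in L⁴ -/

instance completeSpaceH : CompleteSpace spaceH :=
  smoothDivFreeL2.isClosed_topologicalClosure.completeSpace_coe

instance dualNormedAddCommGroup : NormedAddCommGroup (StrongDual ℝ spaceV) :=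
  ContinuousLinearMap.toNormedAddCommGroup

/-- Separability lets countably many test fields decide an identity in 𝓥', hence with a single null
set of times. -/
instance secondCountableTopologyH1Ambient : SecondCountableTopology H1Ambient := by
  have : Fact ((2 : ℝ≥0∞) ≠ ⊤) := ⟨by simp⟩
  have : SecondCountableTopology (PiLp 2 (fun _ : Fin 3 => L2)) :=
    (PiLp.continuousLinearEquiv 2 ℝ (fun _ : Fin 3 => L2)).toHomeomorph.secondCountableTopology
  exact (WithLp.prodContinuousLinearEquiv 2 ℝ L2
    (PiLp 2 (fun _ : Fin 3 => L2))).toHomeomorph.secondCountableTopology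

theorem coe_incl (v : spaceV) : (incl v : L2) = (v : H1Ambient).fst := rfl

theorem dense_smooth_spaceV : Dense {v : spaceV | (v : H1Ambient) ∈ smoothDivFreeH1} := by
  intro v
  rw [closure_subtype]
  have hv : (v : H1Ambient) ∈ closure (smoothDivFreeH1 : Set H1Ambient) := v.2
  refine closure_mono ?_ hv
  intro w hw
  exact ⟨⟨w, subset_closure hw⟩, hw, rfl⟩

theorem norm_incl_le (v : spaceV) : ‖incl v‖ ≤ ‖v‖ :=
  WithLp.norm_fst_le _ (v : H1Ambient)

theorem norm_dV_le (v : spaceV) (i : Fin 3) : ‖dV v i‖ ≤ ‖v‖ :=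
  (PiLp.norm_apply_le (v : H1Ambient).snd i).trans (WithLp.norm_snd_le _ (v : H1Ambient))

theorem IsSmooth.memLp {f : Torus → E3} (hf : IsSmooth f) (p : ℝ≥0∞) : MemLp f p volume :=
  hf.continuous.memLp_of_hasCompactSupport (HasCompactSupport.of_compactSpace f)

theorem IsSmooth.memLp_partialDeriv {f : Torus → E3} (hf : IsSmooth f) (i : Fin 3) (p : ℝ≥0∞) :
    MemLp (partialDeriv i f) p volume :=
  (hf.continuous_partialDeriv i).memLp_of_hasCompactSupport
    (HasCompactSupport.of_compactSpace _)

/-- The Sobolev embedding `𝓥 ⊂ [L⁴(𝕋³)]³`. -/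
theorem exists_eLpNorm_four_incl_le : ∃ C : ℝ≥0, ∀ v : spaceV,
    eLpNorm (incl v : L2) 4 volume ≤ C * ‖v‖ₑ := by
  obtain ⟨C, hC⟩ := exists_eLpNorm_four_le
  have hs : ∀ v : spaceV, (v : H1Ambient) ∈ smoothDivFreeH1 →
      -- The 4 counts the field and its three partial derivatives, each bounded by `‖v‖`.
      eLpNorm (incl v : L2) 4 volume ≤ (C * 4 : ℝ≥0) * ‖v‖ₑ := by
    rintro v ⟨f, hf, hvf, hvf'⟩
    rw [coe_incl, eLpNorm_congr_ae hvf]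
    refine (hC f hf.1).trans ?_
    rw [← eLpNorm_congr_ae hvf, ← Lp.enorm_def]
    have h1 : ‖(v : H1Ambient).fst‖ₑ ≤ ‖v‖ₑ := enorm_le_iff_norm_le.2 (norm_incl_le v)
    have h2 : ∀ i, eLpNorm (partialDeriv i f) 2 volume ≤ ‖v‖ₑ := fun i => by
      rw [← eLpNorm_congr_ae (hvf' i), ← Lp.enorm_def]
      exact enorm_le_iff_norm_le.2 (norm_dV_le v i)
    calc (C : ℝ≥0∞) * (‖(v : H1Ambient).fst‖ₑ + ∑ i, eLpNorm (partialDeriv i f) 2 volume)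
        ≤ C * (‖v‖ₑ + ∑ _i : Fin 3, ‖v‖ₑ) := by
          gcongr with i
          exact h2 i
      _ = _ := by simp; ring
  refine ⟨C * 4, fun v => ?_⟩
  obtain ⟨x, hx, hxv⟩ := mem_closure_iff_seq_limit.1 (dense_smooth_spaceV v)
  have hlim : Tendsto (fun n => (incl (x n) : L2)) atTop (𝓝 (incl v : L2)) :=
    (continuous_subtype_val.comp incl.continuous).continuousAt.tendsto.comp hxv
  -- Convergence in L² gives almost everywhere convergence along a subsequence, and Fatou then
  -- passes the L⁴ bound to the limit.
  obtain ⟨ns, hns, hae⟩ := (tendstoInMeasure_of_tendsto_Lp hlim).exists_seq_tendsto_ae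
  refine (Lp.eLpNorm_lim_le_liminf_eLpNorm (f := fun n => (incl (x (ns n)) : L2))
    (fun n => Lp.aestronglyMeasurable _) _ hae).trans ?_
  have hb : Tendsto (fun n => ((C * 4 : ℝ≥0) : ℝ≥0∞) * ‖x (ns n)‖ₑ) atTop
      (𝓝 ((C * 4 : ℝ≥0) * ‖v‖ₑ)) :=
    ENNReal.Tendsto.const_mul ((hxv.comp hns.tendsto_atTop).enorm) (Or.inr ENNReal.coe_ne_top)
  rw [← hb.liminf_eq]
  exact liminf_le_liminf (Eventually.of_forall fun n => hs _ (hx _))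

theorem memLp_four_incl (v : spaceV) : MemLp (incl v : L2) 4 volume := by
  obtain ⟨C, hC⟩ := exists_eLpNorm_four_incl_le
  exact ⟨Lp.aestronglyMeasurable _,
    (hC v).trans_lt (ENNReal.mul_lt_top ENNReal.coe_lt_top enorm_lt_top)⟩

/-- The inclusion `𝓥 ⊂ [L⁴(𝕋³)]³`. -/
def inclL4ₗ : spaceV →ₗ[ℝ] Lp E3 4 (volume : Measure Torus) where
  toFun v := (memLp_four_incl v).toLp _
  map_add' v w := by
    rw [← MemLp.toLp_add]
    refine MemLp.toLp_congr _ _ ?_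
    rw [map_add]
    exact Lp.coeFn_add _ _
  map_smul' c v := by
    rw [RingHom.id_apply, ← MemLp.toLp_const_smul]
    refine MemLp.toLp_congr _ _ ?_
    rw [map_smul]
    exact Lp.coeFn_smul _ _

theorem exists_norm_inclL4ₗ_le : ∃ C : ℝ, ∀ v, ‖inclL4ₗ v‖ ≤ C * ‖v‖ := by
  obtain ⟨C, hC⟩ := exists_eLpNorm_four_incl_le
  refine ⟨C, fun v => ?_⟩
  change ‖(memLp_four_incl v).toLp _‖ ≤ _
  rw [Lp.norm_toLp]
  refine ENNReal.toReal_le_of_le_ofReal (by positivity) ((hC v).trans (le_of_eq ?_))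
  rw [ENNReal.ofReal_mul C.coe_nonneg, ENNReal.ofReal_coe_nnreal, ofReal_norm]

instance factOneLeFour : Fact ((1 : ℝ≥0∞) ≤ 4) := ⟨by norm_num⟩

/-- The continuous inclusion `𝓥 ⊂ [L⁴(𝕋³)]³`. -/
def inclL4 : spaceV →L[ℝ] Lp E3 4 (volume : Measure Torus) :=
  inclL4ₗ.mkContinuousOfExistsBound exists_norm_inclL4ₗ_le

theorem coeFn_inclL4 (v : spaceV) : inclL4 v =ᵐ[volume] (incl v : L2) :=
  (memLp_four_incl v).coeFn_toLp

/-! ### Convection and diffusion as elements of 𝓥' -/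

instance holderTripleFourFourTwo : ENNReal.HolderTriple 4 4 2 := ⟨by
  rw [show (4 : ℝ≥0∞) = 2 * 2 by norm_num, ENNReal.mul_inv (by simp) (by simp), ← mul_add,
    ENNReal.inv_two_add_inv_two, mul_one]⟩

/-- The bilinear map `(a, b) ↦ aᵢ b`. -/
def coordSmul (i : Fin 3) : E3 →L[ℝ] E3 →L[ℝ] E3 :=
  (ContinuousLinearMap.lsmul ℝ ℝ).comp (EuclideanSpace.proj i)

theorem coordSmul_apply (i : Fin 3) (a b : E3) : coordSmul i a b = a i • b := rfl

/-- Multiplication `(v, w) ↦ vᵢ w`, from `L⁴ × L⁴` to `L²`. -/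
def mulCoord (i : Fin 3) :
    Lp E3 4 (volume : Measure Torus) →L[ℝ] Lp E3 4 (volume : Measure Torus) →L[ℝ] L2 :=
  (coordSmul i).holderL volume 4 4 2

theorem coeFn_mulCoord (i : Fin 3) (v w : spaceV) :
    mulCoord i (inclL4 v) (inclL4 w)
      =ᵐ[volume] fun x => (incl v : L2) x i • (incl w : L2) x := by
  have h : mulCoord i (inclL4 v) (inclL4 w)
      =ᵐ[volume] fun x => coordSmul i (inclL4 v x) (inclL4 w x) :=
    (coordSmul i).coeFn_holder _ _
  filter_upwards [h, coeFn_inclL4 v, coeFn_inclL4 w] with x h1 h2 h3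
  rw [h1, h2, h3, coordSmul_apply]

/-- The derivative `∂ᵢ` as a continuous linear map `𝓥 → [L²(𝕋³)]³`. -/
def dVL (i : Fin 3) : spaceV →L[ℝ] L2 :=
  (PiLp.proj 2 (fun _ : Fin 3 => L2) i).comp
    ((WithLp.sndL 2 ℝ L2 (PiLp 2 (fun _ : Fin 3 => L2))).comp spaceV.subtypeL)

theorem dVL_apply (i : Fin 3) (v : spaceV) : dVL i v = dV v i := rfl

/-- The trilinear form `w ↦ ⟨(v · ∇)v, w⟩` as an element of `𝓥'`. -/
def convectionDual (v : spaceV) : StrongDual ℝ spaceV :=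
  -- The factor vᵢ is attached to w rather than to ∂ᵢv: vᵢw lies in L² by Hölder and pairs with ∂ᵢv
  -- ∈ L².
  ∑ i, ((innerSL ℝ (dV v i)).comp (mulCoord i (inclL4 v))).comp inclL4

theorem continuous_convectionDual : Continuous convectionDual := by
  refine continuous_finsetSum _ fun i _ => ?_
  have h1 : Continuous fun v : spaceV => innerSL ℝ (dV v i) :=
    (innerSL ℝ).continuous.comp (dVL i).continuous
  have h2 : Continuous fun v : spaceV => mulCoord i (inclL4 v) :=
    (mulCoord i).continuous.comp inclL4.continuous
  exact (h1.clm_comp h2).clm_comp continuous_const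

/-- Quadratic growth is exactly what u ∈ L²(0,T;𝓥) can integrate in time. -/
theorem exists_norm_convectionDual_le : ∃ C : ℝ, ∀ v, ‖convectionDual v‖ ≤ C * ‖v‖ ^ 2 := by
  refine ⟨∑ i, ‖mulCoord i‖ * ‖inclL4‖ * ‖inclL4‖, fun v => ?_⟩
  rw [Finset.sum_mul]
  refine (norm_sum_le (E := StrongDual ℝ spaceV) _ _).trans (Finset.sum_le_sum fun i _ => ?_)
  calc ‖((innerSL ℝ (dV v i)).comp (mulCoord i (inclL4 v))).comp inclL4‖
      ≤ ‖innerSL ℝ (dV v i)‖ * ‖mulCoord i (inclL4 v)‖ * ‖inclL4‖ :=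
        (ContinuousLinearMap.opNorm_comp_le _ _).trans
          (mul_le_mul_of_nonneg_right (ContinuousLinearMap.opNorm_comp_le _ _)
            (ContinuousLinearMap.opNorm_nonneg _))
    _ ≤ ‖v‖ * (‖mulCoord i‖ * (‖inclL4‖ * ‖v‖)) * ‖inclL4‖ := by
        have h1 : ‖innerSL ℝ (dV v i)‖ ≤ ‖v‖ := by
          rw [innerSL_apply_norm ℝ]; exact norm_dV_le v i
        have h2 : ‖mulCoord i (inclL4 v)‖ ≤ ‖mulCoord i‖ * (‖inclL4‖ * ‖v‖) :=
          ((mulCoord i).le_opNorm _).trans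
            (mul_le_mul_of_nonneg_left (inclL4.le_opNorm v) (norm_nonneg _))
        gcongr
    _ = _ := by ring

theorem convectionDual_apply (v w : spaceV) :
    convectionDual v w = pairing (convection v) (incl w : L2) := by
  have h1 : convectionDual v w
      = ∑ i, inner ℝ (dV v i) (mulCoord i (inclL4 v) (inclL4 w)) := by
    simp [convectionDual]
  rw [h1, pairing]
  simp_rw [L2.inner_def]
  rw [← integral_finsetSum _ fun i _ => L2.integrable_inner _ _]
  refine integral_congr_ae ?_
  filter_upwards [coeFn_mulCoord 0 v w, coeFn_mulCoord 1 v w, coeFn_mulCoord 2 v w]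
    with x h0 h1 h2
  simp [convection, Fin.sum_univ_three, h0, h1, h2, inner_add_left, inner_smul_left,
    inner_smul_right]

/-- Expand ∂ᵢ(fᵢ|f|²) and sum over i: the term with div f drops out, what remains is twice the
integrand, and each ∂ᵢ integrates to zero. -/
theorem IsSmoothDivFree.integral_convection {f : Torus → E3} (hf : IsSmoothDivFree f) :
    ∫ x, ∑ i, f x i * inner ℝ (partialDeriv i f x) (f x) = 0 := by
  have hc := hf.1.continuous
  have hdc := hf.1.continuous_partialDeriv
  have hp : ∀ i x, HasDerivAt
      (fun s : ℝ => (fun y => f y i * inner ℝ (f y) (f y))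
        (x + Pi.single i (s : AddCircle (2 * Real.pi))))
      (partialDeriv i f x i * inner ℝ (f x) (f x)
        + f x i * (2 * inner ℝ (partialDeriv i f x) (f x))) 0 := by
    intro i x
    have h := hf.1.hasDerivAt i x
    have h1 := (EuclideanSpace.proj (𝕜 := ℝ) i : E3 →L[ℝ] ℝ).hasFDerivAt.comp_hasDerivAt (0 : ℝ) h
    have h2 := h1.mul (h.inner ℝ h)
    refine h2.congr_deriv ?_
    simp only [Function.comp_def, PiLp.proj_apply, AddCircle.coe_zero, Pi.single_zero,
      add_zero]
    rw [real_inner_comm (partialDeriv i f x) (f x)]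
    ring
  have hcp : ∀ i j, Continuous fun x => partialDeriv i f x j := fun i j =>
    (EuclideanSpace.proj (𝕜 := ℝ) j : E3 →L[ℝ] ℝ).continuous.comp (hdc i)
  have hci : ∀ j, Continuous fun x => f x j := fun j =>
    (EuclideanSpace.proj (𝕜 := ℝ) j : E3 →L[ℝ] ℝ).continuous.comp hc
  have hc' : ∀ i, Continuous fun x => partialDeriv i f x i * inner ℝ (f x) (f x)
      + f x i * (2 * inner ℝ (partialDeriv i f x) (f x)) := fun i =>
    ((hcp i i).mul (hc.inner hc)).add ((hci i).mul (continuous_const.mul ((hdc i).inner hc)))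
  have h0 : ∀ i, ∫ x, (partialDeriv i f x i * inner ℝ (f x) (f x)
      + f x i * (2 * inner ℝ (partialDeriv i f x) (f x))) = 0 := fun i =>
    integral_eq_zero_of_hasDerivAt ((hci i).mul (hc.inner hc)) (hc' i) (hp i)
  have hsum : ∫ x, ∑ i, (partialDeriv i f x i * inner ℝ (f x) (f x)
      + f x i * (2 * inner ℝ (partialDeriv i f x) (f x))) = 0 := by
    rw [integral_finsetSum _ fun i _ => (hc' i).integrable_of_hasCompactSupport
      (HasCompactSupport.of_compactSpace _)]
    exact Finset.sum_eq_zero fun i _ => h0 i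
  have e : ∀ x, ∑ i, (partialDeriv i f x i * inner ℝ (f x) (f x)
      + f x i * (2 * inner ℝ (partialDeriv i f x) (f x)))
      = 2 * ∑ i, f x i * inner ℝ (partialDeriv i f x) (f x) := by
    intro x
    have hd := hf.2 x
    rw [divergence] at hd
    rw [Finset.sum_add_distrib, ← Finset.sum_mul, hd, zero_mul, zero_add, Finset.mul_sum]
    exact Finset.sum_congr rfl fun i _ => by ring
  simp_rw [e] at hsum
  rw [integral_const_mul] at hsum
  linarith

/-- The cancellation `⟨(v · ∇)v, v⟩ = 0`. -/
theorem convectionDual_self (v : spaceV) : convectionDual v v = 0 := by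
  -- The identity is a closed condition on 𝓥, so smooth fields suffice.
  have hclosed : IsClosed {v : spaceV | convectionDual v v = 0} :=
    isClosed_eq (continuous_convectionDual.clm_apply continuous_id) continuous_const
  refine hclosed.closure_subset_iff.2 ?_ (dense_smooth_spaceV v)
  rintro v ⟨f, hf, hvf, hvf'⟩
  rw [mem_ofPred_eq, convectionDual_apply, ← hf.integral_convection, pairing]
  refine integral_congr_ae ?_
  filter_upwards [hvf, hvf' 0, hvf' 1, hvf' 2] with x h h0 h1 h2
  simp [convection, coe_incl, dV, Fin.sum_univ_three, h, h0, h1, h2, inner_add_left,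
    inner_smul_left]

/-- The form `w ↦ ⟨∇v, ∇w⟩` as an element of `𝓥'`. -/
def gradDual (v : spaceV) : StrongDual ℝ spaceV :=
  ∑ i, (innerSL ℝ (dV v i)).comp (dVL i)

/-- The velocity `Δv - (v · ∇)v` of the evolution, as an element of `𝓥'`. -/
def rhsDual (v : spaceV) : StrongDual ℝ spaceV := -gradDual v - convectionDual v

theorem gradDual_apply (v w : spaceV) : gradDual v w = ∑ i, inner ℝ (dV v i) (dV w i) := by
  simp [gradDual, dVL_apply]

theorem continuous_gradDual : Continuous gradDual := by
  refine continuous_finsetSum _ fun i _ => ?_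
  have h1 : Continuous fun v : spaceV => innerSL ℝ (dV v i) :=
    (innerSL ℝ).continuous.comp (dVL i).continuous
  exact h1.clm_comp continuous_const

theorem exists_norm_gradDual_le : ∃ C : ℝ, ∀ v, ‖gradDual v‖ ≤ C * ‖v‖ := by
  refine ⟨∑ i, ‖dVL i‖, fun v => ?_⟩
  rw [Finset.sum_mul]
  refine (norm_sum_le (E := StrongDual ℝ spaceV) _ _).trans (Finset.sum_le_sum fun i _ => ?_)
  refine (ContinuousLinearMap.opNorm_comp_le _ _).trans ?_
  rw [innerSL_apply_norm ℝ, mul_comm]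
  exact mul_le_mul_of_nonneg_left (norm_dV_le v i) (ContinuousLinearMap.opNorm_nonneg _)

theorem rhsDual_self (v : spaceV) : rhsDual v v = -gradNormSq v := by
  simp [rhsDual, convectionDual_self, gradDual_apply, gradNormSq]

theorem continuous_gradNormSq : Continuous gradNormSq :=
  continuous_finsetSum _ fun i _ => ((dVL i).continuous.norm).pow 2

theorem gradNormSq_nonneg (v : spaceV) : 0 ≤ gradNormSq v :=
  Finset.sum_nonneg fun _ _ => sq_nonneg _

theorem gradNormSq_le (v : spaceV) : gradNormSq v ≤ 3 * ‖v‖ ^ 2 := by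
  calc gradNormSq v ≤ ∑ _i : Fin 3, ‖v‖ ^ 2 := Finset.sum_le_sum fun i _ => by
        have := norm_dV_le v i
        gcongr
    _ = _ := by simp

/-- A smooth field comes with its derivatives, so it lifts to 𝓥. Hence an element of 𝓗 and its norm
are determined by its action on 𝓥. -/
theorem denseRange_incl : DenseRange incl := by
  intro h
  rw [closure_subtype]
  have hh : (h : L2) ∈ closure (smoothDivFreeL2 : Set L2) := h.2
  refine closure_mono ?_ hh
  rintro w ⟨f, hf, hwf⟩
  let z : H1Ambient := WithLp.toLp 2 (w, WithLp.toLp 2 fun i =>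
    (hf.1.memLp_partialDeriv i 2).toLp _)
  have hz : z ∈ smoothDivFreeH1 :=
    ⟨f, hf, hwf, fun i => (hf.1.memLp_partialDeriv i 2).coeFn_toLp⟩
  exact ⟨incl ⟨z, subset_closure hz⟩, mem_range_self _, rfl⟩

theorem toVDual_apply (h : spaceH) (v : spaceV) : toVDual h v = inner ℝ h (incl v) := rfl

theorem toVDual_injective : Function.Injective toVDual := by
  intro h k hhk
  refine denseRange_incl.eq_of_inner_left (𝕜 := ℝ) fun v => ?_
  exact congrArg (fun l : StrongDual ℝ spaceV => l v) hhk

/-! ### The equation integrated in time, with values in 𝓥' -/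

variable {u₀ : spaceH} {u : ℝ → spaceV}

/-- A continuous function of at most quadratic growth, composed with a weak solution, is locally
integrable in time. -/
theorem IsWeakSolution.intervalIntegrable_comp {E : Type*} [NormedAddCommGroup E]
    (hu : IsWeakSolution u₀ u) {Φ : spaceV → E} (hΦ : Continuous Φ) {C : ℝ}
    (hC : ∀ v, ‖Φ v‖ ≤ C * (‖v‖ + ‖v‖ ^ 2)) {a b : ℝ} (ha : 0 ≤ a) (hb : 0 ≤ b) :
    IntervalIntegrable (fun t => Φ (u t)) volume a b := by
  set T := max a b + 1 with hT
  have hT0 : 0 < T := by have := le_max_left a b; linarith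
  have hmem := hu.memL2V T hT0
  have hint : Integrable (fun t => Φ (u t)) (volume.restrict (Ioo 0 T)) := by
    have h1 : Integrable (fun t => ‖u t‖) (volume.restrict (Ioo 0 T)) :=
      (hmem.integrable (by norm_num)).norm
    have h2 : Integrable (fun t => ‖u t‖ ^ 2) (volume.restrict (Ioo 0 T)) :=
      hmem.integrable_norm_pow (by norm_num)
    exact ((h1.add h2).const_mul C).mono'
      (hΦ.comp_aestronglyMeasurable hmem.aestronglyMeasurable) (ae_of_all _ fun t => hC (u t))
  have hint' : IntegrableOn (fun t => Φ (u t)) (Ioc 0 (max a b)) :=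
    IntegrableOn.mono_set hint (fun t ht => ⟨ht.1, by linarith [ht.2]⟩)
  refine intervalIntegrable_iff.2 (hint'.mono_set ?_)
  rw [uIoc]
  exact Ioc_subset_Ioc_left (le_min ha hb)

theorem IsWeakSolution.intervalIntegrable_gradDual (hu : IsWeakSolution u₀ u) {a b : ℝ}
    (ha : 0 ≤ a) (hb : 0 ≤ b) : IntervalIntegrable (fun t => gradDual (u t)) volume a b := by
  obtain ⟨C, hC⟩ := exists_norm_gradDual_le
  refine hu.intervalIntegrable_comp (C := |C|) continuous_gradDual (fun v => (hC v).trans ?_) ha hb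
  calc C * ‖v‖ ≤ |C| * ‖v‖ := by gcongr; exact le_abs_self C
    _ ≤ |C| * (‖v‖ + ‖v‖ ^ 2) := by gcongr; linarith [sq_nonneg ‖v‖]

theorem IsWeakSolution.intervalIntegrable_convectionDual (hu : IsWeakSolution u₀ u) {a b : ℝ}
    (ha : 0 ≤ a) (hb : 0 ≤ b) : IntervalIntegrable (fun t => convectionDual (u t)) volume a b := by
  obtain ⟨C, hC⟩ := exists_norm_convectionDual_le
  refine hu.intervalIntegrable_comp (C := |C|) continuous_convectionDual
    (fun v => (hC v).trans ?_) ha hb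
  calc C * ‖v‖ ^ 2 ≤ |C| * ‖v‖ ^ 2 := by gcongr; exact le_abs_self C
    _ ≤ |C| * (‖v‖ + ‖v‖ ^ 2) := by gcongr; linarith [norm_nonneg v]

theorem IsWeakSolution.intervalIntegrable_rhsDual (hu : IsWeakSolution u₀ u) {a b : ℝ}
    (ha : 0 ≤ a) (hb : 0 ≤ b) : IntervalIntegrable (fun t => rhsDual (u t)) volume a b :=
  (hu.intervalIntegrable_gradDual ha hb).neg.sub (hu.intervalIntegrable_convectionDual ha hb)

theorem IsWeakSolution.intervalIntegrable_gradNormSq (hu : IsWeakSolution u₀ u) {a b : ℝ}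
    (ha : 0 ≤ a) (hb : 0 ≤ b) : IntervalIntegrable (fun t => gradNormSq (u t)) volume a b := by
  refine hu.intervalIntegrable_comp (C := 3) continuous_gradNormSq (fun v => ?_) ha hb
  rw [Real.norm_of_nonneg (gradNormSq_nonneg v)]
  linarith [gradNormSq_le v, norm_nonneg v]

/-- The version of a weak solution in `C([0, ∞), 𝓥')`, obtained by integrating the equation. -/
def evolution (u₀ : spaceH) (u : ℝ → spaceV) (t : ℝ) : StrongDual ℝ spaceV :=
  toVDual u₀ + ∫ r in (0 : ℝ)..t, rhsDual (u r)

theorem evolution_zero : evolution u₀ u 0 = toVDual u₀ := by simp [evolution]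

theorem IsWeakSolution.continuousOn_evolution (hu : IsWeakSolution u₀ u) :
    ContinuousOn (evolution u₀ u) (Ici 0) := by
  intro t ht
  have h := intervalIntegral.continuousOn_primitive_interval' (E := StrongDual ℝ spaceV)
    (μ := volume) (b₁ := 0) (b₂ := t + 1)
    (hu.intervalIntegrable_rhsDual le_rfl (by linarith [mem_Ici.1 ht])) left_mem_uIcc
  have ht0 : 0 ≤ t := ht
  rw [uIcc_of_le (by linarith)] at h
  have h2 : ContinuousWithinAt (fun t => ∫ r in (0 : ℝ)..t, rhsDual (u r)) (Ici 0) t :=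
    (h t ⟨ht0, by linarith⟩).mono_of_mem_nhdsWithin
      (mem_nhdsWithin.2 ⟨Iio (t + 1), isOpen_Iio, by simp, fun x hx => ⟨hx.2, le_of_lt hx.1⟩⟩)
  exact continuousWithinAt_const.add h2

theorem IsSmoothDivFree.isTestFunction {f : Torus → E3} (hf : IsSmoothDivFree f)
    (χ : ContDiffBump (0 : ℝ)) : IsTestFunction fun t => χ t • f where
  smooth := (χ.contDiff.comp contDiff_fst).smul
    (ContDiff.comp (g := fun y : Fin 3 → ℝ => f (proj y)) hf.1 contDiff_snd)
  compactSupport := ⟨χ.rOut, fun t ht => by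
    have : χ t = 0 := χ.zero_of_le_dist (by
      rw [Real.dist_eq, sub_zero]; exact ht.trans (le_abs_self t))
    rw [this, zero_smul]⟩
  divFree t _ := (hf.smul (χ t)).2

/-- The weak formulation tested with a time-independent field. -/
theorem IsWeakSolution.ae_toVDual_apply_eq (hu : IsWeakSolution u₀ u) {v : spaceV}
    (hv : (v : H1Ambient) ∈ smoothDivFreeH1) :
    ∀ᵐ s ∂(volume.restrict (Ioi (0 : ℝ))), toVDual (incl (u s)) v = evolution u₀ u s v := by
  obtain ⟨f, hf, hvf, hvf'⟩ := hv
  have hpair : ∀ h : spaceH, pairing (h : L2) f = toVDual h v := by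
    intro h
    rw [toVDual_apply, Submodule.coe_inner, L2.inner_def, pairing]
    refine integral_congr_ae ?_
    filter_upwards [hvf] with x hx
    rw [coe_incl, hx]
  have hgrad : ∀ w : spaceV, gradPairing w f = gradDual w v := by
    intro w
    rw [gradDual_apply, gradPairing]
    refine Finset.sum_congr rfl fun i _ => ?_
    rw [L2.inner_def, pairing]
    refine integral_congr_ae ?_
    filter_upwards [hvf' i] with x hx
    rw [dV, dV, hx]
  have hconv : ∀ w : spaceV, pairing (convection w) f = convectionDual w v := by
    intro w
    rw [convectionDual_apply, pairing, pairing]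
    refine integral_congr_ae ?_
    filter_upwards [hvf] with x hx
    rw [coe_incl, hx]
  have main : ∀ n : ℕ, ∀ᵐ s ∂(volume.restrict (Ioi (0 : ℝ))), s < (n : ℝ) →
      toVDual (incl (u s)) v = evolution u₀ u s v := by
    intro n
    -- For s < n the cutoff is 1 on a neighbourhood of each t ∈ (0, s], the endpoint s included, so
    -- the time-derivative term vanishes.
    let χ : ContDiffBump (0 : ℝ) := ⟨n + 1, n + 2, by positivity, by linarith⟩
    filter_upwards [hu.weakForm _ (hf.isTestFunction χ), ae_restrict_mem measurableSet_Ioi]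
      with s hs hs0 hsn
    rw [mem_Ioi] at hs0
    have hχ : ∀ t : ℝ, 0 ≤ t → t < n + 1 → χ t = 1 := fun t h0 h1 =>
      χ.one_of_mem_closedBall (by
        rw [Metric.mem_closedBall, Real.dist_eq, sub_zero, abs_of_nonneg h0]; exact h1.le)
    have hd : ∀ t, 0 < t → t ≤ s → timeDeriv (fun t => χ t • f) t = 0 := by
      intro t h0 h1
      funext x
      have he : (fun r => (χ r • f) x) =ᶠ[𝓝 t] fun _ => f x := by
        filter_upwards [Ioo_mem_nhds h0 (show t < n + 1 by linarith)] with r hr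
        simp [hχ r hr.1.le hr.2]
      rw [timeDeriv, he.deriv_eq, deriv_const, Pi.zero_apply]
    have i1 : ∫ t in (0 : ℝ)..s, pairing (incl (u t) : L2) (timeDeriv (fun t => χ t • f) t)
        = 0 := by
      refine intervalIntegral.integral_zero_ae (ae_of_all _ fun t ht => ?_)
      rw [uIoc_of_le hs0.le] at ht
      simp [hd t ht.1 ht.2, pairing]
    have i2 : ∫ t in (0 : ℝ)..s, gradPairing (u t) (χ t • f)
        = (∫ t in (0 : ℝ)..s, gradDual (u t)) v := by
      rw [ContinuousLinearMap.intervalIntegral_apply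
        (hu.intervalIntegrable_gradDual le_rfl hs0.le)]
      refine intervalIntegral.integral_congr fun t ht => ?_
      rw [uIcc_of_le hs0.le] at ht
      simp only [hχ t ht.1 (by linarith [ht.2]), one_smul, hgrad]
    have i3 : ∫ t in (0 : ℝ)..s, pairing (convection (u t)) (χ t • f)
        = (∫ t in (0 : ℝ)..s, convectionDual (u t)) v := by
      rw [ContinuousLinearMap.intervalIntegral_apply
        (hu.intervalIntegrable_convectionDual le_rfl hs0.le)]
      refine intervalIntegral.integral_congr fun t ht => ?_
      rw [uIcc_of_le hs0.le] at ht
      simp only [hχ t ht.1 (by linarith [ht.2]), one_smul, hconv]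
    rw [i1, i2, i3, hχ 0 le_rfl (by positivity), hχ s hs0.le (by linarith), one_smul, hpair,
      hpair] at hs
    have i4 : ∫ t in (0 : ℝ)..s, rhsDual (u t)
        = -(∫ t in (0 : ℝ)..s, gradDual (u t)) - ∫ t in (0 : ℝ)..s, convectionDual (u t) := by
      rw [← intervalIntegral.integral_neg]
      exact intervalIntegral.integral_sub (hu.intervalIntegrable_gradDual le_rfl hs0.le).neg
        (hu.intervalIntegrable_convectionDual le_rfl hs0.le)
    rw [evolution, i4]
    simp only [add_apply, sub_apply, neg_apply]
    linarith
  filter_upwards [ae_all_iff.2 main] with s hs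
  obtain ⟨n, hn⟩ := exists_nat_gt s
  exact hs n hn

/-- At almost every time, a weak solution agrees with its version in `C([0, ∞), 𝓥')`. -/
theorem IsWeakSolution.ae_toVDual_eq (hu : IsWeakSolution u₀ u) :
    ∀ᵐ s ∂(volume.restrict (Ioi (0 : ℝ))), toVDual (incl (u s)) = evolution u₀ u s := by
  have : TopologicalSpace.SeparableSpace {v : spaceV | (v : H1Ambient) ∈ smoothDivFreeH1} :=
    (TopologicalSpace.IsSeparable.of_separableSpace _).separableSpace
  obtain ⟨t, hts, htc, htd⟩ := dense_smooth_spaceV.exists_countable_dense_subset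
  filter_upwards [(ae_ball_iff htc).2 fun v hv => hu.ae_toVDual_apply_eq (hts hv)] with s hs
  exact ContinuousLinearMap.coeFn_injective <| Continuous.ext_on htd
    (ContinuousLinearMap.continuous _) (ContinuousLinearMap.continuous _) fun v hv => hs v hv

/-! ### From almost every time to every time -/

theorem exists_mem_Ioo_of_ae {p : ℝ → Prop} (h : ∀ᵐ s ∂(volume.restrict (Ioi (0 : ℝ))), p s)
    {a b : ℝ} (ha : 0 ≤ a) (hab : a < b) : ∃ s ∈ Ioo a b, p s := by
  have hd := Measure.dense_of_ae ((ae_restrict_iff' measurableSet_Ioi).1 h)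
  obtain ⟨s, hs, hps⟩ := hd.exists_mem_open isOpen_Ioo (nonempty_Ioo.2 hab)
  exact ⟨s, hps, hs (ha.trans_lt hps.1)⟩

/-- A set of full measure accumulates at every time from the right, so closed conditions that hold
almost everywhere pass to one-sided limits at every time. -/
theorem frequently_nhdsGT_of_ae {p : ℝ → Prop}
    (h : ∀ᵐ s ∂(volume.restrict (Ioi (0 : ℝ))), p s) {t : ℝ} (ht : 0 ≤ t) :
    ∃ᶠ s in 𝓝[>] t, p s := by
  intro hn
  obtain ⟨b, hb, hsub⟩ := mem_nhdsGT_iff_exists_Ioo_subset.1 hn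
  obtain ⟨s, hs, hps⟩ := exists_mem_Ioo_of_ae h ht hb
  exact hsub hs hps

theorem frequently_nhdsLT_of_ae {p : ℝ → Prop}
    (h : ∀ᵐ s ∂(volume.restrict (Ioi (0 : ℝ))), p s) {t : ℝ} (ht : 0 < t) :
    ∃ᶠ s in 𝓝[<] t, p s := by
  intro hn
  obtain ⟨a, ha, hsub⟩ := mem_nhdsLT_iff_exists_Ioo_subset.1 hn
  obtain ⟨s, hs, hps⟩ := exists_mem_Ioo_of_ae h (le_max_right a 0) (max_lt ha ht)
  exact hsub ⟨(le_max_left a 0).trans_lt hs.1, hs.2⟩ hps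

/-- A `𝓥'`-continuous version of a weak solution coincides with the integrated equation. -/
theorem IsWeakSolution.toVDual_eq_evolution (hu : IsWeakSolution u₀ u) {w : ℝ → spaceH}
    (hw : IsVersion w u) (hwc : ContinuousOn (fun t => toVDual (w t)) (Ici 0)) {t : ℝ}
    (ht : 0 ≤ t) : toVDual (w t) = evolution u₀ u t := by
  have hae : ∀ᵐ s ∂(volume.restrict (Ioi (0 : ℝ))),
      toVDual (w s) - evolution u₀ u s = 0 := by
    filter_upwards [hw, hu.ae_toVDual_eq] with s h1 h2
    rw [h1, h2, sub_self]
  have hlim : Tendsto (fun s => toVDual (w s) - evolution u₀ u s) (𝓝[>] t)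
      (𝓝 (toVDual (w t) - evolution u₀ u t)) :=
    ((hwc.sub hu.continuousOn_evolution) t ht).mono_left
      (nhdsWithin_mono t fun s hs => ht.trans (le_of_lt hs))
  exact sub_eq_zero.1 (isClosed_singleton.mem_of_frequently_of_tendsto
    (frequently_nhdsGT_of_ae hae ht) hlim)

theorem EnergyInequalityFrom.norm_le {w : ℝ → spaceH} {s t : ℝ}
    (h : EnergyInequalityFrom u w s) (hst : s < t) : ‖w t‖ ≤ ‖w s‖ := by
  have h1 := h t hst
  have h2 : 0 ≤ ∫ r in s..t, gradNormSq (u r) :=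
    intervalIntegral.integral_nonneg hst.le fun r _ => gradNormSq_nonneg _
  exact le_of_sq_le_sq (by linarith) (norm_nonneg _)

/-! ### Leray–Hopf solutions have a version with non-increasing norm -/

/-- A function satisfying the strong energy inequality can be modified on a null set of times so
that its norm is non-increasing. -/
theorem exists_antitoneOn_of_energyInequality {w : ℝ → spaceH} (hw : IsVersion w u)
    (h0 : EnergyInequalityFrom u w 0)
    (hae : ∀ᵐ s ∂(volume.restrict (Ioi (0 : ℝ))), EnergyInequalityFrom u w s) :
    ∃ ubar : ℝ → spaceH, IsVersion ubar u ∧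
      AntitoneOn (fun t => ‖ubar t‖ ^ 2) (Ici 0) ∧ ubar 0 = w 0 := by
  classical
  let S : ℝ → Set ℝ := fun t => (fun r => ‖w r‖) '' {r | 0 ≤ r ∧ r < t ∧ EnergyInequalityFrom u w r}
  -- At a bad time only the norm matters, and it is set to the infimum of the norms at earlier good
  -- times. A multiple of `w 0` realises it; if `w 0 = 0` the infimum is 0 as well, so division by
  -- zero does no harm.
  let ubar : ℝ → spaceH := fun t =>
    if EnergyInequalityFrom u w t then w t else (sInf (S t) / ‖w 0‖) • w 0
  have hS0 : ∀ t, ∀ x ∈ S t, 0 ≤ x := by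
    rintro t x ⟨r, -, rfl⟩
    exact norm_nonneg _
  have hbdd : ∀ t, BddBelow (S t) := fun t => ⟨0, fun x hx => hS0 t x hx⟩
  have hmem0 : ∀ t, 0 < t → ‖w 0‖ ∈ S t := fun t ht => ⟨0, ⟨le_rfl, ht, h0⟩, rfl⟩
  have hgood : ∀ t, EnergyInequalityFrom u w t → ubar t = w t := fun t ht => if_pos ht
  have hbad : ∀ t, 0 ≤ t → ¬ EnergyInequalityFrom u w t → 0 < t ∧ ‖ubar t‖ = sInf (S t) := by
    intro t ht hn
    have ht0 : 0 < t := lt_of_le_of_ne ht fun h => hn (h ▸ h0)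
    refine ⟨ht0, ?_⟩
    have hle : sInf (S t) ≤ ‖w 0‖ := csInf_le (hbdd t) (hmem0 t ht0)
    have hnn : 0 ≤ sInf (S t) := Real.sInf_nonneg (hS0 t)
    simp only [ubar, if_neg hn, norm_smul, norm_div, norm_norm, Real.norm_of_nonneg hnn]
    rcases eq_or_ne ‖w 0‖ 0 with hw0 | hw0
    · rw [hw0, mul_zero]; linarith
    · field_simp
  have hanti : ∀ s t, 0 ≤ s → s < t → ‖ubar t‖ ≤ ‖ubar s‖ := by
    intro s t hs hst
    by_cases hPs : EnergyInequalityFrom u w s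
    · rw [hgood s hPs]
      by_cases hPt : EnergyInequalityFrom u w t
      · rw [hgood t hPt]; exact hPs.norm_le hst
      · rw [(hbad t (hs.trans hst.le) hPt).2]
        exact csInf_le (hbdd t) ⟨s, ⟨hs, hst, hPs⟩, rfl⟩
    · obtain ⟨hs0, hns⟩ := hbad s hs hPs
      rw [hns]
      -- Any good time r before s also precedes t, so its norm bounds `‖ubar t‖` whether t is good
      -- or bad.
      refine le_csInf ⟨_, hmem0 s hs0⟩ ?_
      rintro x ⟨r, ⟨hr0, hrs, hPr⟩, rfl⟩
      by_cases hPt : EnergyInequalityFrom u w t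
      · rw [hgood t hPt]; exact hPr.norm_le (hrs.trans hst)
      · rw [(hbad t (hs.trans hst.le) hPt).2]
        exact csInf_le (hbdd t) ⟨r, ⟨hr0, hrs.trans hst, hPr⟩, rfl⟩
  refine ⟨ubar, ?_, ?_, hgood 0 h0⟩
  · filter_upwards [hw, hae] with t h1 h2
    rw [hgood t h2, h1]
  · intro s hs t _ hst
    rcases hst.eq_or_lt with rfl | hlt
    · exact le_rfl
    · exact pow_le_pow_left₀ (norm_nonneg _) (hanti s t hs hlt) 2

/-! ### Non-increasing norm implies the strong energy inequality -/

/-- Weak lower semicontinuity of the 𝓗-norm, in dual form: an 𝓗-bound at times accumulating at t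
from the right survives the limit in 𝓥'. -/
theorem IsWeakSolution.abs_evolution_apply_le (hu : IsWeakSolution u₀ u) {t M : ℝ} (ht : 0 ≤ t)
    (h : ∃ᶠ r in 𝓝[>] t, toVDual (incl (u r)) = evolution u₀ u r ∧ ‖incl (u r)‖ ≤ M)
    (v : spaceV) : |evolution u₀ u t v| ≤ M * ‖incl v‖ := by
  have hlim : Tendsto (fun r => evolution u₀ u r) (𝓝[>] t) (𝓝 (evolution u₀ u t)) :=
    (hu.continuousOn_evolution t ht).mono_left
      (nhdsWithin_mono t fun s hs => ht.trans (le_of_lt hs))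
  have hlim2 : Tendsto (fun r => |evolution u₀ u r v|) (𝓝[>] t) (𝓝 |evolution u₀ u t v|) :=
    ((ContinuousLinearMap.apply ℝ ℝ v).continuous.abs.tendsto _).comp hlim
  refine le_of_tendsto_of_frequently hlim2 (h.mono fun r hr => ?_)
  rw [← hr.1, toVDual_apply]
  exact (abs_real_inner_le_norm _ _).trans (mul_le_mul_of_nonneg_right hr.2 (norm_nonneg _))

/-- A functional bounded in the 𝓗-norm on the dense subspace 𝓥 extends to 𝓗, where the Riesz theorem
represents it. -/
theorem exists_toVDual_eq {l : StrongDual ℝ spaceV} {M : ℝ} (h : ∀ v, |l v| ≤ M * ‖incl v‖) :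
    ∃ k : spaceH, toVDual k = l := by
  have hd : DenseRange (incl : spaceV →ₗ[ℝ] spaceH) := denseRange_incl
  let L : StrongDual ℝ spaceH := (l : spaceV →ₗ[ℝ] ℝ).extendOfNorm (incl : spaceV →ₗ[ℝ] spaceH)
  refine ⟨(InnerProductSpace.toDual ℝ spaceH).symm L, ContinuousLinearMap.ext fun v => ?_⟩
  rw [toVDual_apply, InnerProductSpace.toDual_symm_apply]
  exact LinearMap.extendOfNorm_eq hd ⟨M, h⟩ v

theorem norm_le_of_abs_toVDual_apply_le {k : spaceH} {M : ℝ} (hM : 0 ≤ M)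
    (h : ∀ v, |toVDual k v| ≤ M * ‖incl v‖) : ‖k‖ ≤ M := by
  have hall : |inner ℝ k k| ≤ M * ‖k‖ :=
    denseRange_incl.induction_on (p := fun x : spaceH => |inner ℝ k x| ≤ M * ‖x‖) k
      (isClosed_le (by fun_prop) (by fun_prop)) h
  rw [real_inner_self_eq_norm_sq, abs_of_nonneg (sq_nonneg _), sq] at hall
  rcases eq_or_ne ‖k‖ 0 with hk | hk
  · rwa [hk]
  · exact le_of_mul_le_mul_right hall (lt_of_le_of_ne (norm_nonneg _) hk.symm)

/-- At almost every time, the time derivative of the evolution exists in `𝓥'`. -/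
theorem IsWeakSolution.ae_hasDerivAt_evolution (hu : IsWeakSolution u₀ u) {T : ℝ} (hT : 0 ≤ T) :
    ∀ᵐ t, t ∈ Icc 0 T → HasDerivAt (evolution u₀ u) (rhsDual (u t)) t := by
  filter_upwards [(hu.intervalIntegrable_rhsDual le_rfl hT).ae_hasDerivAt_integral] with t h ht
  rw [uIcc_of_le hT] at h
  exact (h ht 0 ⟨le_rfl, hT⟩).const_add (toVDual u₀)

/-- If the norm of a version of a weak solution is non-increasing, then the version satisfies the
energy inequality. -/
theorem IsWeakSolution.energyInequalityFrom (hu : IsWeakSolution u₀ u) {ubar : ℝ → spaceH}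
    (hv : IsVersion ubar u) (hmono : AntitoneOn (fun t => ‖ubar t‖ ^ 2) (Ici 0)) {s : ℝ}
    (hs : 0 ≤ s) : EnergyInequalityFrom u ubar s := by
  intro t hst
  have ht : 0 ≤ t := hs.trans hst.le
  let g : ℝ → ℝ := fun r => -(1 / 2 * ‖ubar r‖ ^ 2)
  have hg : MonotoneOn g (uIcc s t) := by
    rw [uIcc_of_le hst.le]
    intro a ha b hb hab
    have := hmono (hs.trans ha.1) (hs.trans hb.1) hab
    simp only [g] at this ⊢
    linarith
  have hgood : ∀ᵐ r ∂(volume.restrict (Ioi (0 : ℝ))),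
      ubar r = incl (u r) ∧ toVDual (ubar r) = evolution u₀ u r := by
    filter_upwards [hv, hu.ae_toVDual_eq] with r h1 h2
    exact ⟨h1, by rw [h1, h2]⟩
  -- The time r is kept fixed and `u r` serves as test field in 𝓥, so the derivative of `evolution`
  -- in 𝓥' is enough and no chain rule for ‖u‖² is needed.
  have hderiv : ∀ᵐ r, r ∈ Ioo s t → gradNormSq (u r) ≤ deriv g r := by
    filter_upwards [hg.ae_differentiableWithinAt_of_mem, hu.ae_hasDerivAt_evolution ht,
      (ae_restrict_iff' measurableSet_Ioi).1 hgood] with r h1 h2 h3 hr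
    rw [uIcc_of_le hst.le] at h1
    have hr0 : 0 < r := hs.trans_lt hr.1
    have hd := ((h1 (Ioo_subset_Icc_self hr)).differentiableAt
      (Icc_mem_nhds hr.1 hr.2)).hasDerivAt
    have hE := h2 ⟨hr0.le, hr.2.le⟩
    obtain ⟨hr1, hr2⟩ := h3 hr0
    have hE' : HasDerivAt (fun q => evolution u₀ u q (u r)) (rhsDual (u r) (u r)) r :=
      (ContinuousLinearMap.apply ℝ ℝ (u r)).hasFDerivAt.comp_hasDerivAt r hE
    have l1 := (hasDerivAt_iff_tendsto_slope_left_right.1 hd).1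
    have l2 := (hasDerivAt_iff_tendsto_slope_left_right.1 hE').1.neg
    rw [rhsDual_self, neg_neg] at l2
    have hlt : ∀ᶠ q in 𝓝[<] r, q < r := eventually_mem_nhdsWithin
    -- Quotients from the left give the needed sign: for q < r, ‖ū(r) − ū(q)‖² ≥ 0 yields ⟨ū(q) −
    -- ū(r), ū(r)⟩ ≤ ½‖ū(q)‖² − ½‖ū(r)‖². Both limits exist, so it suffices to compare along good
    -- times q.
    refine le_of_tendsto_of_tendsto_of_frequently l2 l1
      (((frequently_nhdsLT_of_ae hgood hr0).and_eventually hlt).mono ?_)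
    rintro q ⟨⟨hq1, hq2⟩, hqr⟩
    rw [slope_def_field, slope_def_field, ← neg_div]
    have hsq : 0 ≤ ‖ubar r - ubar q‖ ^ 2 := sq_nonneg _
    rw [norm_sub_sq_real] at hsq
    rw [← neg_div_neg_eq, ← neg_div_neg_eq (g q - g r)]
    refine div_le_div_of_nonneg_right ?_ (by linarith)
    rw [← hq2, ← hr2, toVDual_apply, toVDual_apply, ← hr1, real_inner_self_eq_norm_sq,
      real_inner_comm]
    simp only [g]
    linarith
  have hint : ∫ r in s..t, gradNormSq (u r) ≤ ∫ r in s..t, deriv g r := by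
    refine intervalIntegral.integral_mono_ae_restrict hst.le
      (hu.intervalIntegrable_gradNormSq hs ht) hg.intervalIntegrable_deriv ?_
    rw [← restrict_Ioo_eq_restrict_Icc]
    exact (ae_restrict_iff' measurableSet_Ioo).2 hderiv
  -- For monotone `g` the integral of the derivative is at most the increment; jumps or a singular
  -- part of `g` can make this strict.
  have hle := hg.intervalIntegral_deriv_mem_uIcc
  have hgst : g s ≤ g t := hg left_mem_uIcc right_mem_uIcc hst.le
  rw [uIcc_of_le (by linarith)] at hle
  have := hle.2
  simp only [g] at this hint
  linarith

/-- A weak solution with a version of non-increasing norm is a Leray–Hopf weak solution. -/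
theorem IsWeakSolution.isLerayHopf_of_antitoneOn (hu : IsWeakSolution u₀ u) {ubar : ℝ → spaceH}
    (hv : IsVersion ubar u) (hmono : AntitoneOn (fun t => ‖ubar t‖ ^ 2) (Ici 0))
    (h0 : ‖ubar 0‖ = ‖u₀‖) : IsLerayHopf u₀ u := by
  have hE := fun s (hs : 0 ≤ s) => hu.energyInequalityFrom hv hmono (s := s) hs
  have hgood : ∀ᵐ r ∂(volume.restrict (Ioi (0 : ℝ))),
      ubar r = incl (u r) ∧ toVDual (incl (u r)) = evolution u₀ u r := by
    filter_upwards [hv, hu.ae_toVDual_eq] with r h1 h2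
    exact ⟨h1, h2⟩
  -- The uniform bound `‖ubar r‖ ≤ ‖ubar 0‖` keeps the 𝓥'-continuous version in 𝓗 at every time, not
  -- just almost every one.
  have hlift : ∀ t, 0 ≤ t → ∃ k : spaceH, toVDual k = evolution u₀ u t := fun t ht =>
    exists_toVDual_eq (hu.abs_evolution_apply_le (M := ‖ubar 0‖) ht
      (((frequently_nhdsGT_of_ae hgood ht).and_eventually eventually_mem_nhdsWithin).mono
        fun r ⟨⟨h1, h2⟩, h3⟩ => ⟨h2, h1 ▸ (hE 0 le_rfl).norm_le (ht.trans_lt h3)⟩))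
  choose! w hw using hlift
  have hwu : IsVersion w u := by
    filter_upwards [hgood, ae_restrict_mem measurableSet_Ioi] with r h1 h2
    exact toVDual_injective ((hw r (le_of_lt h2)).trans h1.2.symm)
  have hw0 : w 0 = u₀ := toVDual_injective ((hw 0 le_rfl).trans evolution_zero)
  have key : ∀ s, 0 ≤ s → ‖w s‖ = ‖ubar s‖ → EnergyInequalityFrom u w s := by
    intro s hs hws t hst
    have ht : 0 ≤ t := hs.trans hst.le
    -- Twice the energy left at time t. It bounds `‖ubar r‖ ^ 2` for all r > t, as dissipation after
    -- t only helps, and letting r ↓ t through good times transfers the bound to `w t`.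
    set K := ‖ubar s‖ ^ 2 - 2 * ∫ r in s..t, gradNormSq (u r) with hK
    have hbound : ∀ r, t < r → ‖ubar r‖ ^ 2 ≤ K := by
      intro r htr
      have h1 := hE s hs r (hst.trans htr)
      have h2 : 0 ≤ ∫ r in t..r, gradNormSq (u r) :=
        intervalIntegral.integral_nonneg htr.le fun r _ => gradNormSq_nonneg _
      rw [← intervalIntegral.integral_add_adjacent_intervals
        (hu.intervalIntegrable_gradNormSq hs ht)
        (hu.intervalIntegrable_gradNormSq ht (ht.trans htr.le))] at h1
      linarith
    have hK0 : 0 ≤ K := (sq_nonneg _).trans (hbound (t + 1) (by linarith))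
    have hnorm : ‖w t‖ ≤ √K := norm_le_of_abs_toVDual_apply_le (Real.sqrt_nonneg K) (by
      rw [hw t ht]
      exact hu.abs_evolution_apply_le ht
        (((frequently_nhdsGT_of_ae hgood ht).and_eventually eventually_mem_nhdsWithin).mono
          fun r ⟨⟨h1, h2⟩, h3⟩ => ⟨h2, h1 ▸ Real.le_sqrt_of_sq_le (hbound r h3)⟩))
    have := pow_le_pow_left₀ (norm_nonneg _) hnorm 2
    rw [Real.sq_sqrt hK0] at this
    rw [hws]
    linarith
  refine ⟨hu, w, hwu, hu.continuousOn_evolution.congr hw, key 0 le_rfl (by rw [hw0, h0]), ?_⟩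
  filter_upwards [hwu, hv, ae_restrict_mem measurableSet_Ioi] with s h1 h2 h3
  exact key s (le_of_lt h3) (by rw [h1, h2])

theorem IsLerayHopf.exists_antitoneOn (h : IsLerayHopf u₀ u) :
    ∃ ubar : ℝ → spaceH, IsVersion ubar u ∧
      AntitoneOn (fun t => ‖ubar t‖ ^ 2) (Ici 0) ∧ ‖ubar 0‖ = ‖u₀‖ := by
  obtain ⟨hu, w, hw, hwc, h0, hae⟩ := h
  obtain ⟨ubar, h1, h2, h3⟩ := exists_antitoneOn_of_energyInequality hw h0 hae
  have hw0 : w 0 = u₀ :=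
    toVDual_injective ((hu.toVDual_eq_evolution hw hwc le_rfl).trans evolution_zero)
  exact ⟨ubar, h1, h2, by rw [h3, hw0]⟩

end NSTorus

end

theorem mainTheorem1 (u₀ : NSTorus.spaceH) (u : ℝ → NSTorus.spaceV)
    (hu : NSTorus.IsWeakSolution u₀ u) :
    (∃ ubar : ℝ → NSTorus.spaceH, NSTorus.IsVersion ubar u ∧
        AntitoneOn (fun t => ‖ubar t‖ ^ 2) (Ici 0) ∧ ‖ubar 0‖ = ‖u₀‖)
      ↔ NSTorus.IsLerayHopf u₀ u :=
  ⟨fun ⟨_, h1, h2, h3⟩ => hu.isLerayHopf_of_antitoneOn h1 h2 h3, fun h => h.exists_antitoneOn⟩
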